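/- **Proposition 4.1.** Let $\mathbb K\in\{\mathbb R,\mathbb C\}$; manifolds are finite-dimensional, without boundary, and smooth (holomorphic if $\mathbb K=\mathbb C$). Let $(G,\pi_G)$ be a connected Poisson Lie group, i.e. a connected Lie group with a Poisson bivector field $\pi_G$ such that multiplication $G\times G\to G$ is a Poisson map for the product Poisson structure, and let $\mathfrak g=T_eG$. Put $\pi^r(g)=(r_{g^{-1}})_*\pi_G(g)\in\bigwedge^2\mathfrak g$, where $r_h$ is right translation by $h$, let $\delta=d_e\pi^r:\mathfrak g\to\bigwedge^2\mathfrak g$, and equip $\mathfrak g^*$ with the dual bracket $\langle[\xi,\eta]_*,X\rangle=\langle\delta(X),\xi\wedge\eta\rangle$. Let $(P,\pi_P)$ be a Poisson manifold and let $\sigma:G\times P\to P$, $\sigma(g,p)=gp$, be a Poisson action, i.e. a smooth left action that is a Poisson map for the product structure $\pi_G\oplus\pi_P$. For $p\in P$ let $\lambda_p:\mathfrak g\to T_pP$ be the differential at $e$ of $g\mapsto gp$, let $\mathfrak g_p=\ker\lambda_p$ be the isotropy subalgebra at $p$, and let $\mathfrak g_p^\circ=\{\xi\in\mathfrak g^*:\xi|_{\mathfrak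 g_p}=0\}$ be its annihilator. Then: 1. The action preserves the Poisson structure of $P$ (that is, for every $g\in G$ the map $\sigma_g:P\to P$, $p\mapsto gp$, is a Poisson map) if and only if for every $p\in P$ the annihilator $\mathfrak g_p^\circ$ is an abelian subalgebra of $(\mathfrak g^*,[\cdot,\cdot]_*)$, i.e. $[\xi,\eta]_*=0$ for all $\xi,\eta\in\mathfrak g_p^\circ$. 2. In particular, if $P\neq\emptyset$ and the action is locally free (that is, $\mathfrak g_p=0$ for every $p\in P$), then the action preserves the Poisson structure of $P$ if and only if $\pi_G=0$. -/

import Mathlib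

open scoped Manifold ContDiff

noncomputable section

section Poisson

variable {𝕜 : Type*} [RCLike 𝕜]
  {E : Type*} [NormedAddCommGroup E] [NormedSpace 𝕜 E]
  {H : Type*} [TopologicalSpace H]
  {E' : Type*} [NormedAddCommGroup E'] [NormedSpace 𝕜 E']
  {H' : Type*} [TopologicalSpace H']

/-- A field of bilinear forms on the cotangent spaces of `M`. In finite dimension, an element of
`⋀² T_p M` is the same as an alternating bilinear form on `T_p^* M`; the alternating and smooth
ones among these fields are the bivector fields (see `IsPoisson`). -/
abbrev CotangentForm (I : ModelWithCorners 𝕜 E H)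
    (M : Type*) [TopologicalSpace M] [ChartedSpace H M] : Type _ :=
  ∀ p : M, LinearMap.BilinForm 𝕜 (Module.Dual 𝕜 (TangentSpace I p))

/-- The differential `df(p)` of a scalar function, as an element of `T_p^* M`. -/
def differential (I : ModelWithCorners 𝕜 E H) {M : Type*} [TopologicalSpace M] [ChartedSpace H M]
    (f : M → 𝕜) (p : M) : Module.Dual 𝕜 (TangentSpace I p) :=
  (mvfderiv I f p).toLinearMap

/-- The bracket `{f, g} = π(df, dg)`. -/
def poissonBracket {I : ModelWithCorners 𝕜 E H} {M : Type*} [TopologicalSpace M]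
    [ChartedSpace H M] (π : CotangentForm I M) (f g : M → 𝕜) (p : M) : 𝕜 :=
  π p (differential I f p) (differential I g p)

/-- `π` is a Poisson structure: it is a smooth bivector field whose bracket satisfies the Jacobi
identity. Both conditions are tested on functions that are smooth (holomorphic if `𝕜 = ℂ`) near a
point, so that the definition also fits complex manifolds, which may have few global
holomorphic functions. -/
structure IsPoisson {I : ModelWithCorners 𝕜 E H} {M : Type*} [TopologicalSpace M]
    [ChartedSpace H M] (π : CotangentForm I M) : Prop where
  alternating : ∀ (p : M) (α : Module.Dual 𝕜 (TangentSpace I p)), π p α α = 0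
  smooth : ∀ (p : M) (f g : M → 𝕜), ContMDiffAt I 𝓘(𝕜, 𝕜) ∞ f p → ContMDiffAt I 𝓘(𝕜, 𝕜) ∞ g p →
    ContMDiffAt I 𝓘(𝕜, 𝕜) ∞ (poissonBracket π f g) p
  jacobi : ∀ (p : M) (f g h : M → 𝕜), ContMDiffAt I 𝓘(𝕜, 𝕜) ∞ f p →
    ContMDiffAt I 𝓘(𝕜, 𝕜) ∞ g p → ContMDiffAt I 𝓘(𝕜, 𝕜) ∞ h p →
    poissonBracket π f (poissonBracket π g h) p + poissonBracket π g (poissonBracket π h f) p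
      + poissonBracket π h (poissonBracket π f g) p = 0

/-- A smooth map whose pull-back of (locally defined) smooth functions preserves brackets. -/
structure IsPoissonMap {I : ModelWithCorners 𝕜 E H} {J : ModelWithCorners 𝕜 E' H'}
    {M : Type*} [TopologicalSpace M] [ChartedSpace H M]
    {N : Type*} [TopologicalSpace N] [ChartedSpace H' N]
    (πM : CotangentForm I M) (πN : CotangentForm J N) (φ : M → N) : Prop where
  smooth : ContMDiff I J ∞ φ
  map_bracket : ∀ (x : M) (f g : N → 𝕜), ContMDiffAt J 𝓘(𝕜, 𝕜) ∞ f (φ x) →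
    ContMDiffAt J 𝓘(𝕜, 𝕜) ∞ g (φ x) →
    poissonBracket πM (f ∘ φ) (g ∘ φ) x = poissonBracket πN f g (φ x)

/-- The product structure `π_M ⊕ π_N`: at `(x, y)` it is the sum of the push-forwards of `π_M(x)`
and `π_N(y)` under the inclusions `M → M × {y}` and `N → {x} × N`. -/
def prodForm {I : ModelWithCorners 𝕜 E H} {J : ModelWithCorners 𝕜 E' H'}
    {M : Type*} [TopologicalSpace M] [ChartedSpace H M]
    {N : Type*} [TopologicalSpace N] [ChartedSpace H' N]
    (πM : CotangentForm I M) (πN : CotangentForm J N) : CotangentForm (I.prod J) (M × N) :=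
  fun z =>
    let ι₁ := (mfderiv I (I.prod J) (fun x : M => (x, z.2)) z.1).toLinearMap.dualMap
    let ι₂ := (mfderiv J (I.prod J) (fun y : N => (z.1, y)) z.2).toLinearMap.dualMap
    (πM z.1).compl₁₂ ι₁ ι₁ + (πN z.2).compl₁₂ ι₂ ι₂

section Group

variable {I : ModelWithCorners 𝕜 E H} {G : Type*} [TopologicalSpace G] [ChartedSpace H G] [Group G]

/-- `(G, π)` is a Poisson Lie group: `π` is Poisson and multiplication is a Poisson map. -/
structure IsPoissonLie (π : CotangentForm I G) : Prop where
  isPoisson : IsPoisson π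
  mul : IsPoissonMap (prodForm π π) π (fun z : G × G => z.1 * z.2)

/-- Differential at `g` of right translation by `g⁻¹`, a map `T_g G → T_e G = 𝔤`. -/
def rightTransport (I : ModelWithCorners 𝕜 E H) (g : G) :
    TangentSpace I g →L[𝕜] GroupLieAlgebra I G :=
  (mfderiv I I (fun h : G => h * g⁻¹) g : TangentSpace I g →L[𝕜] TangentSpace I (g * g⁻¹))

/-- `π^r(g) = r_{g⁻¹} π(g)`, an element of `⋀² 𝔤` viewed as a bilinear form on `𝔤^*`. -/
def rightForm (π : CotangentForm I G) (g : G) :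
    LinearMap.BilinForm 𝕜 (Module.Dual 𝕜 (GroupLieAlgebra I G)) :=
  (π g).compl₁₂ (rightTransport I g).toLinearMap.dualMap (rightTransport I g).toLinearMap.dualMap

/-- The bracket on `𝔤^*` dual to `δ = d_e π^r : 𝔤 → ⋀² 𝔤`:
`⟨[ξ, η]_*, X⟩ = ⟨δ(X), ξ ∧ η⟩`. -/
def dualBracket (π : CotangentForm I G) (ξ η : Module.Dual 𝕜 (GroupLieAlgebra I G)) :
    Module.Dual 𝕜 (GroupLieAlgebra I G) :=
  differential I (fun g : G => rightForm π g ξ η) (1 : G)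

/-- A subspace of `𝔤^*` is an abelian subalgebra for the dual bracket (all brackets of its elements
vanish, so it is in particular closed under the bracket). -/
def IsAbelianSubspace (π : CotangentForm I G)
    (S : Submodule 𝕜 (Module.Dual 𝕜 (GroupLieAlgebra I G))) : Prop :=
  ∀ ξ ∈ S, ∀ η ∈ S, dualBracket π ξ η = 0

variable (I) (J : ModelWithCorners 𝕜 E' H') {P : Type*} [TopologicalSpace P] [ChartedSpace H' P]
  [MulAction G P]

/-- The infinitesimal action at `p`, `X ↦ λ(X)(p) = σ_{p*} X`. -/
def infinitesimalAction (G : Type*) [TopologicalSpace G] [ChartedSpace H G] [Group G]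
    [MulAction G P] (p : P) : GroupLieAlgebra I G →L[𝕜] TangentSpace J ((1 : G) • p) :=
  mfderiv I J (fun g : G => g • p) (1 : G)

/-- The isotropy subalgebra `𝔤_p = {X | λ(X)(p) = 0}`. -/
def isotropyAlgebra (G : Type*) [TopologicalSpace G] [ChartedSpace H G] [Group G]
    [MulAction G P] (p : P) : Submodule 𝕜 (GroupLieAlgebra I G) :=
  LinearMap.ker (infinitesimalAction I J G p).toLinearMap

/-- The action is locally free: every isotropy subalgebra is trivial. -/
def IsLocallyFreeAction (G P : Type*) [TopologicalSpace G] [ChartedSpace H G] [Group G]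
    [TopologicalSpace P] [ChartedSpace H' P] [MulAction G P] : Prop :=
  ∀ p : P, isotropyAlgebra I J G p = ⊥

variable {I J}

/-- The action map `σ : G × P → P` is a Poisson map. -/
def IsPoissonAction (πG : CotangentForm I G) (πP : CotangentForm J P) : Prop :=
  IsPoissonMap (prodForm πG πP) πP (fun z : G × P => z.1 • z.2)

/-- Each `σ_g : P → P` is a Poisson map. -/
def ActionPreserves (G : Type*) [Group G] [MulAction G P] (πP : CotangentForm J P) : Prop :=
  ∀ g : G, IsPoissonMap πP πP (fun x : P => g • x)

end Group

end Poisson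

end

/-! ### Pointwise calculus on manifolds: covectors, Poisson maps, product bivectors. -/

section Calculus

variable {𝕜 : Type*} [RCLike 𝕜]
  {E : Type*} [NormedAddCommGroup E] [NormedSpace 𝕜 E]
  {H : Type*} [TopologicalSpace H] {I : ModelWithCorners 𝕜 E H}
  {E' : Type*} [NormedAddCommGroup E'] [NormedSpace 𝕜 E']
  {H' : Type*} [TopologicalSpace H'] {J : ModelWithCorners 𝕜 E' H'}
  {M : Type*} [TopologicalSpace M] [ChartedSpace H M]
  {N : Type*} [TopologicalSpace N] [ChartedSpace H' N]

/-! A Poisson action satisfies `π_P(gp) = (σ_p)_* π_G(g) + (σ_g)_* π_P(p)`, with `σ_p` the orbit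
map, so it preserves `π_P` iff `(σ_p)_* π_G(g) = 0` for all `g`, `p`. The differential of `σ_p` at
`g` is `λ_{gp}` after right translation by `g⁻¹`, and the transpose of `λ_{gp}` has image the
annihilator of the isotropy algebra at `gp`. Hence preservation means that every `π^r(g)` vanishes
on every annihilator (`IsPoissonAction.actionPreserves_iff`).

Differentiating at `1` makes the annihilators abelian. Conversely, by the cocycle identity `π^r(gh)
= π^r(g) + Ad_g π^r(h)`, the derivative of `π^r(·)(ξ, η)` at `g` is the dual bracket of `ξ ∘ Ad_g`
and `η ∘ Ad_g`, up to a left translation. These covectors annihilate the isotropy algebra at `g⁻¹p`,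
so all derivatives vanish; as `G` is connected and `π^r(1) = 0`, the function is zero
(`IsPoissonLie.rightForm_eq_zero_of_dualBracket`).

For a locally free action the annihilators are all of `𝔤^*`, so preservation forces `π^r = 0`, that
is `π_G = 0`. -/

theorem differential_comp {f : N → 𝕜} {φ : M → N} {x : M}
    (hf : MDifferentiableAt J 𝓘(𝕜, 𝕜) f (φ x)) (hφ : MDifferentiableAt I J φ x) :
    differential I (f ∘ φ) x = differential J f (φ x) ∘ₗ (mfderiv I J φ x).toLinearMap := by
  unfold differential
  rw [mvfderiv_comp x hf hφ]
  rfl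

/-- Every covector is the differential of a function that is smooth near its base point. -/
theorem exists_differential_eq [FiniteDimensional 𝕜 E] [IsManifold I ∞ M] (x : M)
    (α : Module.Dual 𝕜 (TangentSpace I x)) :
    ∃ f : M → 𝕜, ContMDiffAt I 𝓘(𝕜, 𝕜) ∞ f x ∧ differential I f x = α := by
  have : IsManifold I 1 M := .of_le (n := ∞) (by simp)
  let a : E →L[𝕜] 𝕜 := LinearMap.toContinuousLinearMap (E := E) α
  -- The preferred chart at `x` has identity derivative at `x`, so the linear form read in it has
  -- differential `α`.
  refine ⟨a ∘ extChartAt I x, a.contMDiff.contMDiffAt.comp x contMDiffAt_extChartAt, ?_⟩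
  rw [differential_comp a.mdifferentiableAt (mdifferentiableAt_extChartAt (mem_chart_source H x)),
    mfderiv_extChartAt_self]
  ext v
  change mfderiv 𝓘(𝕜, E) 𝓘(𝕜, 𝕜) a _ v = α v
  rw [a.mfderiv_eq]
  rfl

/-- Brackets at a point depend only on differentials there, and every covector is one; this reduces
the condition on functions to linear algebra. -/
theorem isPoissonMap_iff [FiniteDimensional 𝕜 E'] [IsManifold J ∞ N]
    {πM : CotangentForm I M} {πN : CotangentForm J N} {φ : M → N} (hφ : ContMDiff I J ∞ φ) :
    IsPoissonMap πM πN φ ↔ ∀ (x : M) (α β : Module.Dual 𝕜 (TangentSpace J (φ x))),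
      πM x (α ∘ₗ (mfderiv I J φ x).toLinearMap) (β ∘ₗ (mfderiv I J φ x).toLinearMap)
        = πN (φ x) α β := by
  have hd (x : M) : MDifferentiableAt I J φ x := (hφ x).mdifferentiableAt (by simp)
  constructor
  · intro h x α β
    obtain ⟨f, hf, rfl⟩ := exists_differential_eq (I := J) (φ x) α
    obtain ⟨g, hg, rfl⟩ := exists_differential_eq (I := J) (φ x) β
    rw [← differential_comp (hf.mdifferentiableAt (by simp)) (hd x),
      ← differential_comp (hg.mdifferentiableAt (by simp)) (hd x)]
    exact h.map_bracket x f g hf hg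
  · refine fun h => ⟨hφ, fun x f g hf hg => ?_⟩
    unfold poissonBracket
    rw [differential_comp (hf.mdifferentiableAt (by simp)) (hd x),
      differential_comp (hg.mdifferentiableAt (by simp)) (hd x)]
    exact h x _ _

/-- Without boundary the chart target is open in `E`, where a function of zero derivative is locally
constant. -/
theorem isLocallyConstant_of_mfderiv_eq_zero [I.Boundaryless] [IsManifold I 1 M] {f : M → 𝕜}
    (hf : MDifferentiable I 𝓘(𝕜, 𝕜) f) (hf' : ∀ x, mfderiv I 𝓘(𝕜, 𝕜) f x = 0) :
    IsLocallyConstant f := by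
  rw [IsLocallyConstant.iff_eventually_eq]
  intro x
  have ht : IsOpen (extChartAt I x).target := isOpen_extChartAt_target x
  have hs : ∀ z ∈ (extChartAt I x).target,
      MDifferentiableAt 𝓘(𝕜, E) I (extChartAt I x).symm z := fun z hz => by
    have := mdifferentiableWithinAt_extChartAt_symm (I := I) hz
    rwa [I.range_eq_univ, mdifferentiableWithinAt_univ] at this
  have hd : ∀ z ∈ (extChartAt I x).target,
      MDifferentiableAt 𝓘(𝕜, E) 𝓘(𝕜, 𝕜) (f ∘ (extChartAt I x).symm) z := fun z hz =>
    (hf _).comp z (hs z hz)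
  let _ : NormedSpace ℝ E := NormedSpace.restrictScalars ℝ 𝕜 E
  have key := ht.isOpen_inter_preimage_of_fderiv_eq_zero (𝕜 := 𝕜)
    (f := f ∘ (extChartAt I x).symm)
    (fun z hz => (hd z hz).differentiableAt.differentiableWithinAt)
    (fun z hz => by
      have h := mfderiv_comp z (hf ((extChartAt I x).symm z)) (hs z hz)
      rw [hf', mfderiv_eq_fderiv] at h
      exact h.trans (ContinuousLinearMap.zero_comp _)) {f x}
  have hmem : extChartAt I x x ∈
      (extChartAt I x).target ∩ (f ∘ (extChartAt I x).symm) ⁻¹' {f x} :=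
    ⟨mem_extChartAt_target x, by simp⟩
  filter_upwards [(continuousAt_extChartAt x).preimage_mem_nhds (key.mem_nhds hmem),
    extChartAt_source_mem_nhds (I := I) x] with y hy hy'
  have h := hy.2
  rwa [Set.mem_preimage, Function.comp_apply, (extChartAt I x).left_inv hy'] at h

/-- The product bivector has no mixed terms, so its push-forward sees only the two partial maps of
`φ`. -/
theorem prodForm_comp_mfderiv {E'' : Type*} [NormedAddCommGroup E''] [NormedSpace 𝕜 E'']
    {H'' : Type*} [TopologicalSpace H''] {K : ModelWithCorners 𝕜 E'' H''}
    {Q : Type*} [TopologicalSpace Q] [ChartedSpace H'' Q]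
    (πM : CotangentForm I M) (πN : CotangentForm J N) {φ : M × N → Q} {x : M} {y : N}
    (hφ : MDifferentiableAt (I.prod J) K φ (x, y))
    (α β : Module.Dual 𝕜 (TangentSpace K (φ (x, y)))) :
    prodForm πM πN (x, y) (α ∘ₗ (mfderiv (I.prod J) K φ (x, y)).toLinearMap)
        (β ∘ₗ (mfderiv (I.prod J) K φ (x, y)).toLinearMap)
      = πM x (α ∘ₗ (mfderiv I K (fun x' => φ (x', y)) x).toLinearMap)
          (β ∘ₗ (mfderiv I K (fun x' => φ (x', y)) x).toLinearMap)
        + πN y (α ∘ₗ (mfderiv J K (fun y' => φ (x, y')) y).toLinearMap)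
          (β ∘ₗ (mfderiv J K (fun y' => φ (x, y')) y).toLinearMap) := by
  have h₁ : mfderiv I K (fun x' => φ (x', y)) x = _ :=
    mfderiv_comp (f := fun x' : M => (x', y)) x hφ
      (mdifferentiableAt_id.prodMk mdifferentiableAt_const)
  have h₂ : mfderiv J K (fun y' => φ (x, y')) y = _ :=
    mfderiv_comp (f := fun y' : N => (x, y')) y hφ
      (mdifferentiableAt_const.prodMk mdifferentiableAt_id)
  rw [h₁, h₂]
  rfl

/-- The chain rule, with the model vector spaces as tangent spaces, so that the base point of the
outer derivative may be given by any expression. -/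
theorem mfderiv_comp_model {E'' : Type*} [NormedAddCommGroup E''] [NormedSpace 𝕜 E'']
    {H'' : Type*} [TopologicalSpace H''] {K : ModelWithCorners 𝕜 E'' H''}
    {Q : Type*} [TopologicalSpace Q] [ChartedSpace H'' Q] {g : N → Q} {f : M → N} {x : M} {y : N}
    (hg : MDifferentiableAt J K g y) (hf : MDifferentiableAt I J f x) (hy : f x = y) :
    (mfderiv I K (g ∘ f) x : E →L[𝕜] E'')
      = (mfderiv J K g y : E' →L[𝕜] E'') ∘L (mfderiv I J f x : E →L[𝕜] E') := by
  subst hy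
  exact mfderiv_comp x hg hf

end Calculus

/-! ### The cocycle identity on the group and the infinitesimal action. -/

section PoissonLie

variable {𝕜 : Type*} [RCLike 𝕜]
  {E : Type*} [NormedAddCommGroup E] [NormedSpace 𝕜 E]
  {H : Type*} [TopologicalSpace H] {I : ModelWithCorners 𝕜 E H}
  {E' : Type*} [NormedAddCommGroup E'] [NormedSpace 𝕜 E']
  {H' : Type*} [TopologicalSpace H'] {J : ModelWithCorners 𝕜 E' H'}
  {G : Type*} [TopologicalSpace G] [ChartedSpace H G] [Group G]
  {P : Type*} [TopologicalSpace P] [ChartedSpace H' P] [MulAction G P]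

section Group

variable [LieGroup I ∞ G]

variable (I) in
theorem mdifferentiable_mul_left_const (g : G) : MDifferentiable I I (fun x : G => g * x) :=
  (contMDiff_mul_left (I := I) (n := ∞)).mdifferentiable (by simp)

variable (I) in
theorem mdifferentiable_mul_right_const (g : G) : MDifferentiable I I (fun x : G => x * g) :=
  (contMDiff_mul_right (I := I) (n := ∞)).mdifferentiable (by simp)

variable (I) in
/-- The adjoint action of `g` on the Lie algebra, the differential at `1` of conjugation. -/
noncomputable def adjointMap (g : G) : GroupLieAlgebra I G →L[𝕜] GroupLieAlgebra I G :=
  (mfderiv I I (fun x : G => g * x * g⁻¹) 1 :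
    TangentSpace I (1 : G) →L[𝕜] TangentSpace I (g * 1 * g⁻¹))

theorem rightTransport_comp_mul_right (g h : G) :
    rightTransport I (g * h) ∘L mfderiv I I (fun x : G => x * h) g = rightTransport I g := by
  have := mfderiv_comp g (mdifferentiable_mul_right_const I (g * h)⁻¹ (g * h))
    (mdifferentiable_mul_right_const I h g)
  refine this.symm.trans ?_
  have he : (fun x : G => x * (g * h)⁻¹) ∘ (fun x : G => x * h) = fun x => x * g⁻¹ := by
    ext x; simp [mul_assoc]
  rw [he]
  rfl

/-- Differentiate `(gx)(gh)⁻¹ = g(xh⁻¹)g⁻¹` at `x = h`. -/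
theorem rightTransport_comp_mul_left (g h : G) :
    rightTransport I (g * h) ∘L mfderiv I I (fun x : G => g * x) h
      = adjointMap I g ∘L rightTransport I h := by
  have h₁ := mfderiv_comp h (mdifferentiable_mul_right_const I (g * h)⁻¹ (g * h))
    (mdifferentiable_mul_left_const I g h)
  have h₂ := mfderiv_comp_model (J := I) (g := fun x : G => g * x * g⁻¹)
    (f := fun x : G => x * h⁻¹) (x := h) (y := 1)
    ((mdifferentiable_mul_right_const I g⁻¹ _).comp _ (mdifferentiable_mul_left_const I g _))
    (mdifferentiable_mul_right_const I h⁻¹ h) (mul_inv_cancel h)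
  have he : (fun x : G => x * (g * h)⁻¹) ∘ (fun x : G => g * x)
      = (fun x : G => g * x * g⁻¹) ∘ (fun x : G => x * h⁻¹) := by
    ext x; simp [mul_assoc]
  rw [he] at h₁
  exact h₁.symm.trans h₂

theorem rightTransport_injective (g : G) : Function.Injective (rightTransport I g) := by
  have h := mfderiv_comp_model (J := I) (g := fun x : G => x * g) (f := fun x : G => x * g⁻¹)
    (x := g) (y := 1) (mdifferentiable_mul_right_const I g 1)
    (mdifferentiable_mul_right_const I g⁻¹ g) (mul_inv_cancel g)
  have he : (fun x : G => x * g) ∘ (fun x : G => x * g⁻¹) = id := by ext x; simp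
  rw [he, mfderiv_id] at h
  exact Function.LeftInverse.injective (g := mfderiv I I (fun x : G => x * g) 1) fun v =>
    (DFunLike.congr_fun h v).symm

theorem eq_zero_of_rightForm_eq_zero {πG : CotangentForm I G} {g : G}
    (h : rightForm πG g = 0) : πG g = 0 := by
  have hs := LinearMap.dualMap_surjective_of_injective (f := (rightTransport I g).toLinearMap)
    (rightTransport_injective g)
  ext α β
  obtain ⟨ξ, rfl⟩ := hs α
  obtain ⟨η, rfl⟩ := hs β
  exact LinearMap.congr_fun₂ h ξ η

variable [FiniteDimensional 𝕜 E] {πG : CotangentForm I G}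

theorem IsPoissonLie.apply_mul (hG : IsPoissonLie πG) (g h : G)
    (α β : Module.Dual 𝕜 (TangentSpace I (g * h))) :
    πG (g * h) α β
      = πG g (α ∘ₗ (mfderiv I I (fun x : G => x * h) g).toLinearMap)
          (β ∘ₗ (mfderiv I I (fun x : G => x * h) g).toLinearMap)
        + πG h (α ∘ₗ (mfderiv I I (fun x : G => g * x) h).toLinearMap)
          (β ∘ₗ (mfderiv I I (fun x : G => g * x) h).toLinearMap) := by
  have : IsManifold I ∞ G := inferInstance
  have h₁ := (isPoissonMap_iff hG.mul.smooth).1 hG.mul (g, h) α β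
  rw [← h₁]
  exact prodForm_comp_mfderiv πG πG (hG.mul.smooth.mdifferentiable (by simp) (g, h)) α β

/-- The cocycle identity: multiplicativity of `π_G`, right-translated to the identity by `(gh)⁻¹`.
-/
theorem IsPoissonLie.rightForm_mul (hG : IsPoissonLie πG) (g h : G)
    (ξ η : Module.Dual 𝕜 (GroupLieAlgebra I G)) :
    rightForm πG (g * h) ξ η = rightForm πG g ξ η
      + rightForm πG h (ξ ∘ₗ (adjointMap I g).toLinearMap)
          (η ∘ₗ (adjointMap I g).toLinearMap) := by
  have h₁ := hG.apply_mul g h (ξ ∘ₗ (rightTransport I (g * h)).toLinearMap)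
    (η ∘ₗ (rightTransport I (g * h)).toLinearMap)
  have h₂ := congrArg ContinuousLinearMap.toLinearMap (rightTransport_comp_mul_right (I := I) g h)
  have h₃ := congrArg ContinuousLinearMap.toLinearMap (rightTransport_comp_mul_left (I := I) g h)
  rw [ContinuousLinearMap.toLinearMap_comp] at h₂ h₃
  rw [LinearMap.comp_assoc, LinearMap.comp_assoc, LinearMap.comp_assoc, LinearMap.comp_assoc,
    h₂, h₃] at h₁
  exact h₁

theorem IsPoissonLie.rightForm_one (hG : IsPoissonLie πG) : rightForm πG (1 : G) = 0 := by
  ext ξ η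
  have h := hG.rightForm_mul 1 1 ξ η
  have ha : adjointMap I (1 : G) = ContinuousLinearMap.id 𝕜 _ := by
    unfold adjointMap
    have he : (fun x : G => 1 * x * (1 : G)⁻¹) = id := by ext x; simp
    rw [he, mfderiv_id]
  rw [ha, mul_one] at h
  exact left_eq_add.1 h

end Group

section Action

theorem mdifferentiable_const_smul (I : ModelWithCorners 𝕜 E H) (J : ModelWithCorners 𝕜 E' H')
    [ContMDiffSMul I J ∞ G P] (g : G) : MDifferentiable J J (fun p : P => g • p) :=
  ((contMDiff_const (I' := I)).smul contMDiff_id :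
    ContMDiff J J ∞ fun p : P => g • p).mdifferentiable (by simp)

theorem IsPoissonAction.apply_smul [FiniteDimensional 𝕜 E'] [IsManifold J ∞ P]
    {πG : CotangentForm I G} {πP : CotangentForm J P}
    (hσ : IsPoissonAction πG πP) (g : G) (p : P) (α β : Module.Dual 𝕜 (TangentSpace J (g • p))) :
    πP (g • p) α β
      = πG g (α ∘ₗ (mfderiv I J (fun x : G => x • p) g).toLinearMap)
          (β ∘ₗ (mfderiv I J (fun x : G => x • p) g).toLinearMap)
        + πP p (α ∘ₗ (mfderiv J J (fun x : P => g • x) p).toLinearMap)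
          (β ∘ₗ (mfderiv J J (fun x : P => g • x) p).toLinearMap) := by
  have h₁ := (isPoissonMap_iff (IsPoissonMap.smooth hσ)).1 hσ (g, p) α β
  rw [← h₁]
  exact prodForm_comp_mfderiv πG πP (hσ.smooth.mdifferentiable (by simp) (g, p)) α β

variable [ContMDiffSMul I J ∞ G P]

variable (I J) in
theorem mdifferentiable_smul_const (p : P) : MDifferentiable I J (fun g : G => g • p) :=
  (contMDiff_id.smul contMDiff_const : ContMDiff I J ∞ fun g : G => g • p).mdifferentiable
    (by simp)

theorem infinitesimalAction_comp_rightTransport [LieGroup I ∞ G] (g : G) (p : P) :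
    (infinitesimalAction I J G (g • p) : E →L[𝕜] E') ∘L (rightTransport I g : E →L[𝕜] E)
      = (mfderiv I J (fun x : G => x • p) g : E →L[𝕜] E') := by
  have h := mfderiv_comp_model (J := I) (g := fun x : G => x • (g • p))
    (f := fun x : G => x * g⁻¹) (x := g) (y := 1) (mdifferentiable_smul_const I J (g • p) 1)
    (mdifferentiable_mul_right_const I g⁻¹ g) (mul_inv_cancel g)
  have he : (fun x : G => x • (g • p)) ∘ (fun x : G => x * g⁻¹) = fun x => x • p := by
    ext x; simp [mul_smul]
  rw [he] at h
  exact h.symm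

/-- Differentiate `(gxg⁻¹)p = g(x(g⁻¹p))` at `x = 1`. Consequently `Ad_g` carries the isotropy
algebra at `g⁻¹p` into that at `p`. -/
theorem infinitesimalAction_comp_adjointMap [LieGroup I ∞ G] (g : G) (p : P) :
    (infinitesimalAction I J G p : E →L[𝕜] E') ∘L (adjointMap I g : E →L[𝕜] E)
      = (mfderiv J J (fun x : P => g • x) (g⁻¹ • p) : E' →L[𝕜] E') ∘L
        (infinitesimalAction I J G (g⁻¹ • p) : E →L[𝕜] E') := by
  have h₁ := mfderiv_comp_model (J := I) (g := fun x : G => x • p)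
    (f := fun x : G => g * x * g⁻¹) (x := 1) (y := 1) (mdifferentiable_smul_const I J p 1)
    ((mdifferentiable_mul_right_const I g⁻¹ _).comp _ (mdifferentiable_mul_left_const I g _))
    (by simp)
  have h₂ := mfderiv_comp_model (J := J) (g := fun x : P => g • x)
    (f := fun x : G => x • (g⁻¹ • p)) (x := 1) (y := g⁻¹ • p) (mdifferentiable_const_smul I J g _)
    (mdifferentiable_smul_const I J (g⁻¹ • p) 1) (one_smul _ _)
  have he : (fun x : G => x • p) ∘ (fun x : G => g * x * g⁻¹)
      = (fun x : P => g • x) ∘ (fun x : G => x • (g⁻¹ • p)) := by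
    ext x; simp [mul_smul]
  rw [he] at h₁
  exact h₁.symm.trans h₂

theorem comp_adjointMap_mem_dualAnnihilator [LieGroup I ∞ G] {g : G} {p : P}
    {ξ : Module.Dual 𝕜 (GroupLieAlgebra I G)}
    (hξ : ξ ∈ (isotropyAlgebra I J G p).dualAnnihilator) :
    ξ ∘ₗ (adjointMap I g).toLinearMap ∈ (isotropyAlgebra I J G (g⁻¹ • p)).dualAnnihilator := by
  rw [Submodule.mem_dualAnnihilator] at hξ ⊢
  intro X hX
  refine hξ _ ?_
  have h := DFunLike.congr_fun (infinitesimalAction_comp_adjointMap (I := I) (J := J) g p) X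
  have hX' : infinitesimalAction I J G (g⁻¹ • p) X = 0 := hX
  change infinitesimalAction I J G p (adjointMap I g X) = 0
  refine h.trans ?_
  change mfderiv J J (fun x : P => g • x) (g⁻¹ • p) (infinitesimalAction I J G (g⁻¹ • p) X) = 0
  rw [hX']
  exact map_zero _

variable [LieGroup I ∞ G] [FiniteDimensional 𝕜 E'] [IsManifold J ∞ P]
    {πG : CotangentForm I G} {πP : CotangentForm J P}

theorem IsPoissonAction.actionPreserves_iff (hσ : IsPoissonAction πG πP) :
    ActionPreserves G πP ↔ ∀ (g : G) (p : P), ∀ ξ ∈ (isotropyAlgebra I J G p).dualAnnihilator,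
      ∀ η ∈ (isotropyAlgebra I J G p).dualAnnihilator, rightForm πG g ξ η = 0 := by
  have hsm (g : G) : ContMDiff J J ∞ (fun x : P => g • x) :=
    (contMDiff_const (I' := I)).smul contMDiff_id
  -- Covectors are taken on the model space `E'` because `infinitesimalAction` lands in the tangent
  -- space at `1 • (g • p)`, not at `g • p`.
  have hform (g : G) (p : P) (α β : Module.Dual 𝕜 E') :
      rightForm πG g (α ∘ₗ (infinitesimalAction I J G (g • p)).toLinearMap)
          (β ∘ₗ (infinitesimalAction I J G (g • p)).toLinearMap)
        = πG g (α ∘ₗ (mfderiv I J (fun x : G => x • p) g).toLinearMap)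
          (β ∘ₗ (mfderiv I J (fun x : G => x • p) g).toLinearMap) := by
    have h := congrArg (ContinuousLinearMap.toLinearMap)
      (infinitesimalAction_comp_rightTransport (I := I) (J := J) g p)
    rw [ContinuousLinearMap.toLinearMap_comp] at h
    change πG g (α ∘ₗ _ ∘ₗ _) (β ∘ₗ _ ∘ₗ _) = _
    exact congrArg (fun L : E →ₗ[𝕜] E' => πG g (α ∘ₗ L) (β ∘ₗ L)) h
  have hann (p : P) : LinearMap.range (infinitesimalAction I J G p).toLinearMap.dualMap
      = (isotropyAlgebra I J G p).dualAnnihilator :=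
    LinearMap.range_dualMap_eq_dualAnnihilator_ker _
  constructor
  · intro h g p ξ hξ η hη
    obtain ⟨q, rfl⟩ : ∃ q, g • q = p := ⟨g⁻¹ • p, smul_inv_smul g p⟩
    rw [← hann] at hξ hη
    obtain ⟨α, rfl⟩ := hξ
    obtain ⟨β, rfl⟩ := hη
    have h₁ := (isPoissonMap_iff (hsm g)).1 (h g) q α β
    -- Invariance cancels the `π_P` term, leaving the orbit-map term equal to zero.
    exact (hform g q α β).trans (right_eq_add.1 (h₁.trans (hσ.apply_smul g q α β)))
  · intro h g
    rw [isPoissonMap_iff (hsm g)]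
    intro p α β
    have h₁ := h g (g • p) (α ∘ₗ (infinitesimalAction I J G (g • p)).toLinearMap)
      (hann _ ▸ ⟨α, rfl⟩) (β ∘ₗ (infinitesimalAction I J G (g • p)).toLinearMap)
      (hann _ ▸ ⟨β, rfl⟩)
    have h₂ := hσ.apply_smul g p α β
    exact (h₂.trans ((congrArg (· + _) ((hform g p α β).symm.trans h₁)).trans (zero_add _))).symm

end Action

end PoissonLie

/-! ### Differentiability of `π^r` at the identity. -/

section Differentiability

variable {𝕜 : Type*} [RCLike 𝕜]
  {E : Type*} [NormedAddCommGroup E] [NormedSpace 𝕜 E]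
  {H : Type*} [TopologicalSpace H] {I : ModelWithCorners 𝕜 E H}

/-- A covector in the coordinate frame of the chart at `x₀`. -/
theorem eq_sum_smul_differential {M : Type*} [TopologicalSpace M] [ChartedSpace H M]
    [FiniteDimensional 𝕜 E] [IsManifold I 1 M] {ι : Type*} [Fintype ι] (b : Module.Basis ι 𝕜 E) {x₀ x : M}
    (hx : x ∈ (chartAt H x₀).source) (α : Module.Dual 𝕜 (TangentSpace I x)) :
    α = ∑ i, α ((mfderivWithin 𝓘(𝕜, E) I (extChartAt I x₀).symm (Set.range I)
        (extChartAt I x₀ x) : E →L[𝕜] E) (b i)) •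
      differential I (fun y => b.coord i (extChartAt I x₀ y)) x := by
  have hx' : x ∈ (extChartAt I x₀).source := by rwa [extChartAt_source]
  have hinv := mfderivWithin_extChartAt_symm_comp_mfderiv_extChartAt' hx'
  set A : E →L[𝕜] E := mfderivWithin 𝓘(𝕜, E) I (extChartAt I x₀).symm (Set.range I)
        (extChartAt I x₀ x)
  ext v
  let w : E := mfderiv I 𝓘(𝕜, E) (extChartAt I x₀) x v
  have hw : A w = v := DFunLike.congr_fun hinv v
  have hd (i : ι) : differential I (fun y => b.coord i (extChartAt I x₀ y)) x v = b.coord i w := by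
    let c : E →L[𝕜] 𝕜 := LinearMap.toContinuousLinearMap (b.coord i)
    have h := differential_comp (I := I) (J := 𝓘(𝕜, E)) (f := c) (φ := extChartAt I x₀) (x := x)
      c.mdifferentiableAt (mdifferentiableAt_extChartAt hx)
    refine (LinearMap.congr_fun h v).trans ?_
    change mfderiv 𝓘(𝕜, E) 𝓘(𝕜, 𝕜) c _ w = _
    rw [c.mfderiv_eq]
    rfl
  let a : E →ₗ[𝕜] 𝕜 := α
  calc a v = a (A (∑ i, b.repr w i • b i)) := by rw [b.sum_repr, hw]
    _ = ∑ i, a (A (b i)) * b.coord i w := by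
      simp only [map_sum, map_smul, smul_eq_mul, Module.Basis.coord_apply, mul_comm]
    _ = _ := by
      rw [LinearMap.sum_apply]
      exact Finset.sum_congr rfl fun i _ => congrArg (a (A (b i)) * ·) (hd i).symm

variable {G : Type*} [TopologicalSpace G] [ChartedSpace H G] [Group G] [LieGroup I ∞ G]

theorem contMDiffAt_rightTransport (v : E) :
    ContMDiffAt (M' := E) I 𝓘(𝕜, E) 1 (fun g : G => (rightTransport I g : E →L[𝕜] E)
      ((mfderivWithin 𝓘(𝕜, E) I (extChartAt I (1 : G)).symm (Set.range I)
        (extChartAt I (1 : G) g) : E →L[𝕜] E) v)) 1 := by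
  have : IsManifold I 1 G := .of_le (n := ∞) (by simp)
  have hf : ContMDiff (I.prod I) I ∞ (Function.uncurry fun g x : G => x * g⁻¹) :=
    contMDiff_snd.mul contMDiff_fst.inv
  have h := ContMDiffAt.mfderiv_apply (m := 1) (n := ∞) (I := I) (I' := I) (J := I) (J' := I)
    (x₀ := (1 : G)) (fun g x : G => x * g⁻¹) id id (fun _ => v) hf.contMDiffAt contMDiffAt_id
    contMDiffAt_id contMDiffAt_const
    (by rw [one_add_one_eq_two]; exact ENat.LEInfty.out)
  refine h.congr_of_eventuallyEq ?_
  -- The target chart is based at `1 * 1⁻¹` and its derivative is taken at `g * g⁻¹`; both points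
  -- equal `1`, but not definitionally.
  have hid (y z : G) (hy : y = 1) (hz : z = 1) :
      (mfderiv I 𝓘(𝕜, E) (extChartAt I y) z : E →L[𝕜] E) = .id 𝕜 E := by
    subst hy hz
    exact mfderiv_extChartAt_self
  filter_upwards [(chartAt H (1 : G)).open_source.mem_nhds (mem_chart_source H 1)] with g hg
  have hc := inTangentCoordinates_eq_mfderiv_comp (I := I) (I' := I) (f := id)
    (g := fun x : G => x * x⁻¹) (ϕ := fun g => mfderiv I I (fun x : G => x * g⁻¹) g)
    (x₀ := 1) (x := g) hg (by simp)
  have h₁ := hid (1 * 1⁻¹) (g * g⁻¹) (by simp) (by simp)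
  have h₂ := (congrArg (fun L : E →L[𝕜] E => L ∘L ((rightTransport I g : E →L[𝕜] E) ∘L
    (mfderivWithin 𝓘(𝕜, E) I (extChartAt I (1 : G)).symm (Set.range I)
        (extChartAt I (1 : G) g) : E →L[𝕜] E))) h₁).trans (ContinuousLinearMap.id_comp _)
  exact (DFunLike.congr_fun (hc.trans h₂) v).symm

/-- Smoothness of `π_G` is known only through brackets of functions, so `π^r(·)(ξ, η)` is expanded
near `1` in brackets of chart coordinates with `C^1` coefficients. Without this, a zero dual bracket
could merely be the default derivative of a nondifferentiable function. -/
theorem mdifferentiableAt_rightForm [FiniteDimensional 𝕜 E] {πG : CotangentForm I G} (hπ : IsPoisson πG)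
    (ξ η : Module.Dual 𝕜 (GroupLieAlgebra I G)) :
    MDifferentiableAt I 𝓘(𝕜, 𝕜) (fun g : G => rightForm πG g ξ η) 1 := by
  have : IsManifold I 1 G := .of_le (n := ∞) (by simp)
  let b := Module.finBasis 𝕜 E
  let A (g : G) : E →L[𝕜] E := mfderivWithin 𝓘(𝕜, E) I (extChartAt I (1 : G)).symm (Set.range I)
    (extChartAt I (1 : G) g)
  let a (ζ : Module.Dual 𝕜 (GroupLieAlgebra I G)) (i) (g : G) : 𝕜 :=
    ζ ((rightTransport I g : E →L[𝕜] E) (A g (b i)))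
  let x (i) (g : G) : 𝕜 := b.coord i (extChartAt I (1 : G) g)
  have ha (ζ : E →ₗ[𝕜] 𝕜) (i) : ContMDiffAt I 𝓘(𝕜, 𝕜) 1 (a ζ i) 1 :=
    (LinearMap.toContinuousLinearMap ζ).contMDiff.contMDiffAt.comp _
      (contMDiffAt_rightTransport (b i))
  have hx (i) : ContMDiffAt I 𝓘(𝕜, 𝕜) ∞ (x i) 1 :=
    (LinearMap.toContinuousLinearMap (b.coord i)).contMDiff.contMDiffAt.comp _
      contMDiffAt_extChartAt
  have hbr (i j) : ContMDiffAt I 𝓘(𝕜, 𝕜) 1 (poissonBracket πG (x i) (x j)) 1 :=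
    (hπ.smooth 1 _ _ (hx i) (hx j)).of_le (by simp)
  have hsum : ContMDiffAt I 𝓘(𝕜, 𝕜) 1
      (fun g => ∑ i, ∑ j, a ξ i g * (a η j g * poissonBracket πG (x i) (x j) g)) 1 :=
    contMDiffAt_finsetSum fun i _ => contMDiffAt_finsetSum fun j _ =>
      (ha ξ i).mul ((ha η j).mul (hbr i j))
  refine (hsum.congr_of_eventuallyEq ?_).mdifferentiableAt (by simp)
  filter_upwards [(chartAt H (1 : G)).open_source.mem_nhds (mem_chart_source H 1)] with g hg
  have hζ (ζ : Module.Dual 𝕜 (GroupLieAlgebra I G)) :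
      ζ ∘ₗ (rightTransport I g).toLinearMap = ∑ i, a ζ i g • differential I (x i) g :=
    eq_sum_smul_differential b hg _
  change πG g (ξ ∘ₗ (rightTransport I g).toLinearMap) (η ∘ₗ (rightTransport I g).toLinearMap) = _
  rw [hζ, hζ]
  simp only [map_sum, map_smul, LinearMap.sum_apply, LinearMap.smul_apply, smul_eq_mul,
    poissonBracket]
  simp_rw [Finset.mul_sum]
  rw [Finset.sum_comm]
  exact Finset.sum_congr rfl fun i _ => Finset.sum_congr rfl fun j _ => mul_left_comm _ _ _

end Differentiability

/-! ### Integrating over the connected group, and the main theorem. -/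

theorem IsPoissonLie.rightForm_eq_zero_of_dualBracket {𝕜 : Type*} [RCLike 𝕜]
    {E : Type*} [NormedAddCommGroup E] [NormedSpace 𝕜 E] [FiniteDimensional 𝕜 E]
    {H : Type*} [TopologicalSpace H] {I : ModelWithCorners 𝕜 E H} [I.Boundaryless]
    {G : Type*} [TopologicalSpace G] [ChartedSpace H G] [Group G] [LieGroup I ∞ G]
    [ConnectedSpace G] {πG : CotangentForm I G} (hG : IsPoissonLie πG)
    {ξ η : Module.Dual 𝕜 (GroupLieAlgebra I G)}
    (h : ∀ g : G, dualBracket πG (ξ ∘ₗ (adjointMap I g).toLinearMap)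
      (η ∘ₗ (adjointMap I g).toLinearMap) = 0) (g : G) :
    rightForm πG g ξ η = 0 := by
  have : IsManifold I 1 G := .of_le (n := ∞) (by simp)
  let F (g : G) : G → 𝕜 := fun x => rightForm πG x (ξ ∘ₗ (adjointMap I g).toLinearMap)
    (η ∘ₗ (adjointMap I g).toLinearMap)
  have hF (g : G) : HasMFDerivAt I 𝓘(𝕜, 𝕜) (F g) 1 (0 : E →L[𝕜] 𝕜) := by
    have h₁ := (mdifferentiableAt_rightForm hG.isPoisson
      (ξ ∘ₗ (adjointMap I g).toLinearMap) (η ∘ₗ (adjointMap I g).toLinearMap)).hasMFDerivAt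
    have h₂ : mfderiv I 𝓘(𝕜, 𝕜) (F g) 1 = (0 : E →L[𝕜] 𝕜) :=
      ContinuousLinearMap.ext fun v => LinearMap.congr_fun (h g) v
    exact h₂ ▸ h₁
  have hder (g : G) :
      HasMFDerivAt I 𝓘(𝕜, 𝕜) (fun x => rightForm πG x ξ η) g (0 : E →L[𝕜] 𝕜) := by
    -- The cocycle identity for `x = g(g⁻¹x)` moves the derivative at `g` to the identity.
    have he : (fun x => rightForm πG x ξ η)
        = (fun x => rightForm πG g ξ η + F g x) ∘ fun x => g⁻¹ * x := by
      ext x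
      rw [Function.comp_apply, ← hG.rightForm_mul, mul_inv_cancel_left]
    rw [he]
    have h₁ : HasMFDerivAt I 𝓘(𝕜, 𝕜) (fun x => rightForm πG g ξ η + F g x) (g⁻¹ * g)
        (0 : E →L[𝕜] 𝕜) := by
      rw [inv_mul_cancel, ← add_zero (0 : E →L[𝕜] 𝕜)]
      exact (hasMFDerivAt_const (rightForm πG g ξ η) (1 : G)).add (hF g)
    exact h₁.comp g (mdifferentiable_mul_left_const I g⁻¹ g).hasMFDerivAt
  have hc := isLocallyConstant_of_mfderiv_eq_zero (fun g => (hder g).mdifferentiableAt)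
    (fun g => (hder g).mfderiv)
  rw [hc.apply_eq_of_preconnectedSpace g 1, hG.rightForm_one]
  rfl


theorem proposition4p1 {𝕜 : Type*} [RCLike 𝕜]
    {E : Type*} [NormedAddCommGroup E] [NormedSpace 𝕜 E] [FiniteDimensional 𝕜 E]
    {H : Type*} [TopologicalSpace H] (I : ModelWithCorners 𝕜 E H) [I.Boundaryless]
    {E' : Type*} [NormedAddCommGroup E'] [NormedSpace 𝕜 E'] [FiniteDimensional 𝕜 E']
    {H' : Type*} [TopologicalSpace H'] (J : ModelWithCorners 𝕜 E' H') [J.Boundaryless]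
    {G : Type*} [TopologicalSpace G] [ChartedSpace H G] [Group G] [LieGroup I ∞ G]
    [ConnectedSpace G]
    {P : Type*} [TopologicalSpace P] [ChartedSpace H' P] [IsManifold J ∞ P]
    [MulAction G P] [ContMDiffSMul I J ∞ G P]
    (πG : CotangentForm I G) (hG : IsPoissonLie πG)
    (πP : CotangentForm J P) (hP : IsPoisson πP)
    (hσ : IsPoissonAction πG πP) :
    (ActionPreserves G πP ↔
      ∀ p : P, IsAbelianSubspace πG (isotropyAlgebra I J G p).dualAnnihilator) ∧
    (Nonempty P → IsLocallyFreeAction I J G P → (ActionPreserves G πP ↔ πG = 0)) := by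
  have hiff := hσ.actionPreserves_iff
  refine ⟨⟨fun h p ξ hξ η hη => ?_, fun h => ?_⟩, fun hne hfree => ⟨fun h => ?_, fun h => ?_⟩⟩
  · have h₀ : (fun g : G => rightForm πG g ξ η) = fun _ => 0 :=
      funext fun g => hiff.1 h g p ξ hξ η hη
    rw [dualBracket, h₀, differential, mvfderiv_const]
    rfl
  · refine hiff.2 fun g p ξ hξ η hη => hG.rightForm_eq_zero_of_dualBracket (fun x => ?_) g
    -- The hypothesis is needed along the whole orbit: composing with `Ad_x` moves the base point to
    -- `x⁻¹ • p`.
    exact h (x⁻¹ • p) _ (comp_adjointMap_mem_dualAnnihilator hξ) _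
      (comp_adjointMap_mem_dualAnnihilator hη)
  · obtain ⟨p⟩ := hne
    have hmem (ξ : Module.Dual 𝕜 (GroupLieAlgebra I G)) :
        ξ ∈ (isotropyAlgebra I J G p).dualAnnihilator := by
      rw [hfree p, Submodule.dualAnnihilator_bot]
      trivial
    ext1 g
    refine eq_zero_of_rightForm_eq_zero ?_
    ext ξ η
    exact hiff.1 h g p ξ (hmem ξ) η (hmem η)
  · subst h
    exact hiff.2 fun g p ξ _ η _ => rfl
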